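/- Let $(\mathcal X_i,\mathcal A_i,\mu_i)$, $i\in[p]=\{1,\dots,p\}$, be $\sigma$-finite measure spaces such that each $\mathcal A_i$ contains two disjoint sets of positive measure, and let $\mathcal X=\prod_i\mathcal X_i$ carry the product measure $\mu=\bigotimes_i\mu_i$. Let $\mathcal M$ be the set of strictly positive probability densities on $\mathcal X$ with respect to $\mu$; identities between (conditional) densities are understood $\mu$-almost everywhere. For $f\in\mathcal M$ and $A\subseteq[p]$ write $f(x_A)$ for the marginal density of the coordinates in $A$ and, for $a \notin A$, $f(x_a\mid x_A)=f(x_{A\cup\{a\}})/f(x_A)$. For a directed acyclic graph (DAG) $D$ on the vertex set $[p]$ let $\mathrm{pa}_D(a)$ be the set of parents of $a$. The skeleton of $D$ is the underlying undirected graph; a v-structure of $D$ is an induced subgraph $a\to b\leftarrow c$ (with $a\neq c$ and $a,c$ not adjacent). Let $$\mathcal M(D)=\Big\{f\in\mathcal M : f(x)=\prod_{a=1}^p f(x_a\mid x_{\mathrm{pa}_D(a)})\Big\}.$$ Two DAGs $D_1,D_2$ on $[p]$ are called observationally Markov equivalent, $D_1\sim D_2$, if $\mathcal M(D_1)=\mathcal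 M(D_2)$. For $I\subseteq[p]$ the intervention graph $D^{(I)}$ is the DAG on $[p]$ whose arrows are the arrows $a\to b$ of $D$ with $b\notin I$. A family of targets is a finite family $\mathcal I$ of subsets of $[p]$ (repetitions are allowed); it is conservative if for every $a\in[p]$ there is some $I\in\mathcal I$ with $a\notin I$. For a DAG $D$ let $\mathcal M_{\mathcal I}(D)$ be the set of all tuples $(f^{(I)})_{I\in\mathcal I}$ of densities in $\mathcal M$ such that $f^{(I)}\in\mathcal M(D^{(I)})$ for all $I\in\mathcal I$, and $$f^{(I)}(x_a\mid x_{\mathrm{pa}_D(a)})=f^{(J)}(x_a\mid x_{\mathrm{pa}_D(a)})\quad\text{for all } I,J\in\mathcal I \text{ and all } a\notin I\cup J.$$ Write $D_1\sim_{\mathcal I}D_2$ if $\mathcal M_{\mathcal I}(D_1)=\mathcal M_{\mathcal I}(D_2)$. **Theorem.** Let $D_1$ and $D_2$ be DAGs on $[p]$ and let $\mathcal I$ be a conservative family of targets. Then the following statements are equivalent: (i) $D_1\sim_{\mathcal I}D_2$; (ii) $D_1^{(I)}\sim D_2^{(I)}$ for all $I\in\mathcal I$; (iii) for all $I\in\mathcal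 I$, $D_1^{(I)}$ and $D_2^{(I)}$ have the same skeleton and the same v-structures; (iv) $D_1$ and $D_2$ have the same skeleton and the same v-structures, and $D_1^{(I)}$ and $D_2^{(I)}$ have the same skeleton for all $I\in\mathcal I$. -/

import Mathlib

open MeasureTheory
open scoped ENNReal

namespace CausalDAG

/-- A directed acyclic graph on the vertex set `Fin p`. Acyclicity says that no vertex can be
reached from itself along a nonempty sequence of arrows; in particular there are no loops and no
two opposite arrows between the same two vertices. -/
structure DAG (p : ℕ) extends Digraph (Fin p) where
  acyclic : ∀ a, ¬ Relation.TransGen Adj a a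

namespace DAG

variable {p : ℕ}

/-- The set `pa_D(a)` of parents of the vertex `a`. -/
noncomputable def parents (D : DAG p) (a : Fin p) : Finset (Fin p) :=
  open Classical in Finset.univ.filter fun b => D.Adj b a

/-- The intervention graph `D^(I)`: all arrows of `D` that point into `I` are deleted. -/
def intervene (D : DAG p) (I : Finset (Fin p)) : DAG p where
  Adj a b := D.Adj a b ∧ b ∉ I
  acyclic a h := D.acyclic a (Relation.TransGen.mono (fun _ _ hxy => And.left hxy) a a h)

/-- The skeleton of `D`: two vertices are adjacent if there is an arrow between them, in one of
the two directions. -/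
def skeleton (D : DAG p) : SimpleGraph (Fin p) :=
  SimpleGraph.fromRel D.Adj

/-- The v-structures of `D`: triples `(a, b, c)` such that the subgraph of `D` induced on the
three distinct vertices `a`, `b`, `c` is `a → b ← c`. -/
def vStructures (D : DAG p) : Set (Fin p × Fin p × Fin p) :=
  {t | t.1 ≠ t.2.2 ∧ D.Adj t.1 t.2.1 ∧ D.Adj t.2.2 t.2.1 ∧ ¬ D.skeleton.Adj t.1 t.2.2}

end DAG

/-- A family of targets is conservative if every vertex is avoided by at least one target. -/
def Conservative {p J : ℕ} (I : Fin J → Finset (Fin p)) : Prop :=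
  ∀ a : Fin p, ∃ j : Fin J, a ∉ I j

variable {p : ℕ} {X : Fin p → Type*} [∀ i, MeasurableSpace (X i)]

/-- The set of all strictly positive (finite valued, measurable) probability densities with
respect to the product measure `⨂ i, μ i`. -/
def posDensities (μ : ∀ i, Measure (X i)) : Set ((∀ i, X i) → ℝ≥0∞) :=
  {f | Measurable f ∧ (∀ x, 0 < f x ∧ f x < ∞) ∧ ∫⁻ x, f x ∂(Measure.pi μ) = 1}

/-- The marginal density `f(x_A)` of the coordinates in `A`, obtained by integrating out all
other coordinates. It is written as a function of the whole vector `x`, but depends on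
the coordinates in `A` only. -/
noncomputable def marginal (μ : ∀ i, Measure (X i)) (f : (∀ i, X i) → ℝ≥0∞)
    (A : Finset (Fin p)) (x : ∀ i, X i) : ℝ≥0∞ :=
  lmarginal μ Aᶜ f x

/-- The conditional density `f(x_a | x_P) = f(x_{P ∪ {a}}) / f(x_P)`. -/
noncomputable def condDensity (μ : ∀ i, Measure (X i)) (f : (∀ i, X i) → ℝ≥0∞)
    (a : Fin p) (P : Finset (Fin p)) (x : ∀ i, X i) : ℝ≥0∞ :=
  marginal μ f (insert a P) x / marginal μ f P x

/-- `M(D)`: the positive densities obeying the Markov property of `D`, i.e.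
`f(x) = ∏ a, f(x_a | x_{pa_D(a)})`. Identities between densities are understood almost everywhere
with respect to the product measure. -/
def markovDensities (μ : ∀ i, Measure (X i)) (D : DAG p) : Set ((∀ i, X i) → ℝ≥0∞) :=
  {f | f ∈ posDensities μ ∧
    f =ᵐ[Measure.pi μ] fun x => ∏ a : Fin p, condDensity μ f a (D.parents a) x}

/-- `D₁ ∼ D₂`: observational Markov equivalence, `M(D₁) = M(D₂)`. -/
def MarkovEquiv (μ : ∀ i, Measure (X i)) (D₁ D₂ : DAG p) : Prop :=
  markovDensities μ D₁ = markovDensities μ D₂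

/-- `M_I(D)`: the tuples of positive densities, indexed by the targets, such that the `j`-th
density obeys the Markov property of the `j`-th intervention graph, and such that any two of the
densities have the same conditional density of `x_a` given the parents of `a` in `D`, for each
vertex `a` outside both targets. -/
def interventionalDensities (μ : ∀ i, Measure (X i)) {J : ℕ} (I : Fin J → Finset (Fin p))
    (D : DAG p) : Set (Fin J → (∀ i, X i) → ℝ≥0∞) :=
  {f | (∀ j, f j ∈ markovDensities μ (D.intervene (I j))) ∧
    ∀ j k, ∀ a, a ∉ I j ∪ I k →
      condDensity μ (f j) a (D.parents a) =ᵐ[Measure.pi μ] condDensity μ (f k) a (D.parents a)}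

/-- `D₁ ∼_I D₂`: interventional Markov equivalence, `M_I(D₁) = M_I(D₂)`. -/
def InterventionalMarkovEquiv (μ : ∀ i, Measure (X i)) {J : ℕ} (I : Fin J → Finset (Fin p))
    (D₁ D₂ : DAG p) : Prop :=
  interventionalDensities μ I D₁ = interventionalDensities μ I D₂

end CausalDAG

/-! The four statements are linked in the cycle (i) → (ii) → (iii) → (iv) → (i). (i) → (ii): a
density in `M(D₁^(I_j))` is the `j`-th entry, up to null sets, of a tuple in `M_I(D₁)` built from
its own conditional densities (`exists_mem_markovDensities`). (ii) → (iii): Markov classes are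
probed with densities whose only dependence is the parity of a vertex set `S`. Such a density lies
in `M(D)` iff some vertex of `S` has the rest of `S` among its parents
(`parityDensity_mem_markovDensities_iff`). Pairs `S` detect the skeleton, triples the v-structures.
(iii) → (iv): by conservativity, all arrows into a given vertex survive some intervention. (iv) →
(i): DAGs with equal skeleton and v-structures are joined by reversals of covered arrows on which
they disagree (`DAG.covered_reversal_induction`). Equality of the intervened skeletons prevents any
target from separating the two ends of such an arrow, and then Bayes' formula
(`condDensity_ae_eq_of_swap`) shows that the reversal preserves `M_I`. -/

namespace CausalDAG

/-! ### Marginal and conditional densities up to null sets -/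

section Marginals

variable {p : ℕ} {X : Fin p → Type*} [∀ i, MeasurableSpace (X i)]
  {μ : ∀ i, Measure (X i)} {f g : (∀ i, X i) → ℝ≥0∞} {s t A P Q : Finset (Fin p)} {a : Fin p}

theorem dependsOn_lmarginal (μ : ∀ i, Measure (X i)) (f : (∀ i, X i) → ℝ≥0∞)
    (s : Finset (Fin p)) : DependsOn (lmarginal μ s f) (↑sᶜ : Set (Fin p)) :=
  fun _ _ h => lmarginal_congr μ f fun i hi => h i (by simpa using hi)

theorem dependsOn_marginal (μ : ∀ i, Measure (X i)) (f : (∀ i, X i) → ℝ≥0∞)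
    (A : Finset (Fin p)) : DependsOn (marginal μ f A) (A : Set (Fin p)) := by
  have := dependsOn_lmarginal μ f Aᶜ
  rwa [compl_compl] at this

theorem dependsOn_condDensity (μ : ∀ i, Measure (X i)) (f : (∀ i, X i) → ℝ≥0∞)
    (a : Fin p) (P : Finset (Fin p)) :
    DependsOn (condDensity μ f a P) (↑(insert a P) : Set (Fin p)) := by
  intro x y h
  have h' : ∀ i ∈ (P : Set (Fin p)), x i = y i := fun i hi => h i (by simp at hi ⊢; exact .inr hi)
  rw [condDensity, condDensity, dependsOn_marginal μ f _ h, dependsOn_marginal μ f _ h']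

theorem lmarginal_mul_of_dependsOn (hg : DependsOn g (A : Set (Fin p))) (hs : Disjoint A s)
    (hf : Measurable f) :
    lmarginal μ s (fun x => g x * f x) = fun x => g x * lmarginal μ s f x := by
  ext x
  have h : ∀ y : ∀ i : s, X i, g (Function.updateFinset x s y) = g x := fun y =>
    hg fun i hi => by
      simp [Function.updateFinset_def, Finset.disjoint_left.mp hs (Finset.mem_coe.mp hi)]
  simp only [lmarginal, h]
  exact lintegral_const_mul _ (hf.comp measurable_updateFinset)

theorem marginal_univ : marginal μ f Finset.univ = f := by
  ext x
  simp [marginal]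

variable [∀ i, SigmaFinite (μ i)]

theorem lmarginal_sdiff (hf : Measurable f) (hst : s ⊆ t) :
    lmarginal μ (t \ s) (lmarginal μ s f) = lmarginal μ t f := by
  rw [← lmarginal_union μ f hf Finset.sdiff_disjoint, Finset.sdiff_union_of_subset hst]

theorem lmarginal_marginal (hf : Measurable f) (hPA : P ⊆ A) :
    lmarginal μ (A \ P) (marginal μ f A) = marginal μ f P := by
  have h : A \ P = Pᶜ \ Aᶜ := by ext; simp; tauto
  have h' : marginal μ f A = lmarginal μ Aᶜ f := rfl
  rw [h, h', lmarginal_sdiff hf (Finset.compl_subset_compl.mpr hPA)]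
  rfl

theorem marginal_empty :
    marginal μ f ∅ = fun _ => ∫⁻ x, f x ∂(Measure.pi μ) := by
  ext x
  simp [marginal]

theorem measurable_marginal (hf : Measurable f) : Measurable (marginal μ f A) :=
  hf.lmarginal μ

theorem measurable_condDensity (hf : Measurable f) : Measurable (condDensity μ f a P) :=
  (measurable_marginal hf).div (measurable_marginal hf)

theorem ae_eq_zero_of_lmarginal_eq_zero (hf : Measurable f) (h : lmarginal μ s f = 0) :
    f =ᵐ[Measure.pi μ] 0 := by
  rw [← lintegral_eq_zero_iff hf]
  have := lintegral_eq_of_lmarginal_eq (μ := μ) s hf measurable_zero (g := 0)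
    (by rw [h]; ext; simp [lmarginal])
  simpa using this

/-- By Tonelli, integrating out the remaining coordinates gives the total integral, which is zero.
-/
theorem lmarginal_ae_eq_zero (hf : Measurable f) (h : f =ᵐ[Measure.pi μ] 0) :
    lmarginal μ s f =ᵐ[Measure.pi μ] 0 := by
  apply ae_eq_zero_of_lmarginal_eq_zero (hf.lmarginal μ) (s := sᶜ)
  have := lmarginal_sdiff (μ := μ) hf s.subset_univ
  rw [← Finset.compl_eq_univ_sdiff] at this
  rw [this, lmarginal_univ, (lintegral_eq_zero_iff hf).mpr h]
  rfl

theorem lmarginal_ae_congr (hf : Measurable f) (hg : Measurable g) (h : f =ᵐ[Measure.pi μ] g) :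
    lmarginal μ s f =ᵐ[Measure.pi μ] lmarginal μ s g := by
  have key : ∀ f g : (∀ i, X i) → ℝ≥0∞, Measurable f → Measurable g → f =ᵐ[Measure.pi μ] g →
      ∀ᵐ x ∂Measure.pi μ, lmarginal μ s f x ≤ lmarginal μ s g x := by
    intro f g hf hg h
    -- Truncated subtraction reduces to the zero case: `f ≤ g + (f - g)` holds even at infinite
    -- values.
    have hm : Measurable (fun x => f x - g x) := hf.sub hg
    have h0 : (fun x => f x - g x) =ᵐ[Measure.pi μ] 0 := by
      filter_upwards [h] with x hx
      simp [hx]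
    filter_upwards [lmarginal_ae_eq_zero (s := s) hm h0] with x hx
    calc lmarginal μ s f x ≤ lmarginal μ s (fun x => g x + (f x - g x)) x :=
          lmarginal_mono (fun y => le_add_tsub) x
      _ = lmarginal μ s g x + lmarginal μ s (fun x => f x - g x) x :=
          lintegral_add_left (hg.comp measurable_updateFinset) _
      _ = lmarginal μ s g x := by rw [hx]; simp
  filter_upwards [key f g hf hg h, key g f hg hf h.symm] with x h₁ h₂
  exact le_antisymm h₁ h₂

theorem marginal_ae_congr (hf : Measurable f) (hg : Measurable g) (h : f =ᵐ[Measure.pi μ] g) :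
    marginal μ f A =ᵐ[Measure.pi μ] marginal μ g A :=
  lmarginal_ae_congr hf hg h

theorem condDensity_ae_congr (hf : Measurable f) (hg : Measurable g)
    (h : f =ᵐ[Measure.pi μ] g) :
    condDensity μ f a P =ᵐ[Measure.pi μ] condDensity μ g a P := by
  filter_upwards [marginal_ae_congr (A := insert a P) hf hg h,
    marginal_ae_congr (A := P) hf hg h] with x h₁ h₂
  rw [condDensity, condDensity, h₁, h₂]

/-- The marginal is constant in the coordinates outside `A`, so its integral over the whole product
may be infinite. Finiteness is therefore obtained by integrating over `A` alone, with the other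
coordinates fixed. -/
theorem marginal_ae_lt_top (hf : Measurable f) (hint : ∫⁻ x, f x ∂(Measure.pi μ) ≠ ∞) :
    ∀ᵐ x ∂Measure.pi μ, marginal μ f A x < ∞ := by
  have hN : MeasurableSet {x | marginal μ f A x = ∞} :=
    measurable_marginal hf (measurableSet_singleton _)
  have h0 : lmarginal μ A (Set.indicator {x | marginal μ f A x = ∞} 1) = 0 := by
    ext x
    have hm : Measurable fun y : ∀ i : A, X i => marginal μ f A (Function.updateFinset x A y) :=
      (measurable_marginal hf).comp measurable_updateFinset
    have h1 : ∫⁻ y, marginal μ f A (Function.updateFinset x A y)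
        ∂(Measure.pi fun i : A => μ i) ≠ ∞ := by
      have := congrFun (lmarginal_marginal (μ := μ) hf A.empty_subset) x
      rw [Finset.sdiff_empty, marginal_empty] at this
      exact ne_of_eq_of_ne this hint
    have hi : Measurable fun y : ∀ i : A, X i =>
        Set.indicator {x | marginal μ f A x = ∞} (1 : (∀ i, X i) → ℝ≥0∞)
          (Function.updateFinset x A y) :=
      (measurable_one.indicator hN).comp measurable_updateFinset
    refine (lintegral_eq_zero_iff hi).mpr ?_
    filter_upwards [ae_lt_top hm h1] with y hy
    simp [hy.ne]
  filter_upwards [ae_eq_zero_of_lmarginal_eq_zero (measurable_one.indicator hN) h0] with x hx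
  rw [lt_top_iff_ne_top]
  intro h
  rw [Set.indicator_of_mem (by exact h)] at hx
  simp at hx

theorem marginal_pos (hμ : ∀ i, μ i ≠ 0) (hf : Measurable f) (hpos : ∀ x, 0 < f x)
    (x : ∀ i, X i) : 0 < marginal μ f A x := by
  have : ∀ i, NeZero (μ i) := fun i => ⟨hμ i⟩
  have hm : Measurable fun y : ∀ i : (Aᶜ : Finset (Fin p)), X i =>
      f (Function.updateFinset x Aᶜ y) := hf.comp measurable_updateFinset
  refine (lintegral_pos_iff_support hm).mpr ?_
  have : Function.support (fun y => f (Function.updateFinset x Aᶜ y)) = Set.univ := by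
    ext y
    simpa using (hpos _).ne'
  rw [this, Measure.pi_univ]
  exact (Finset.prod_ne_zero_iff.mpr fun i _ => by simpa using hμ i).bot_lt

theorem pi_ne_zero (hμ : ∀ i, μ i ≠ 0) : Measure.pi μ ≠ 0 := by
  intro h
  have h' : Measure.pi μ Set.univ = 0 := by simp [h]
  rw [Measure.pi_univ, Finset.prod_eq_zero_iff] at h'
  obtain ⟨i, -, hi⟩ := h'
  exact hμ i (Measure.measure_univ_eq_zero.mp hi)

/-- The denominator does not involve `x_a`, and integrating the numerator over `x_a` reproduces it.
The identity is only a.e. because the denominator may be infinite on a null set. -/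
theorem lmarginal_condDensity (hμ : ∀ i, μ i ≠ 0) (hf : f ∈ posDensities μ) (ha : a ∉ P) :
    lmarginal μ {a} (condDensity μ f a P) =ᵐ[Measure.pi μ] 1 := by
  obtain ⟨hm, hpos, hint⟩ := hf
  have h : condDensity μ f a P
      = fun x => (marginal μ f P x)⁻¹ * marginal μ f (insert a P) x := by
    ext x
    rw [condDensity, ENNReal.div_eq_inv_mul]
  have hd : DependsOn (fun x => (marginal μ f P x)⁻¹) (P : Set (Fin p)) := fun x y hxy => by
    simp only [dependsOn_marginal μ f P hxy]
  rw [h, lmarginal_mul_of_dependsOn hd (by simpa using ha) (measurable_marginal hm)]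
  have h' : ({a} : Finset (Fin p)) = insert a P \ P := by
    ext; simp; grind
  rw [h', lmarginal_marginal hm (Finset.subset_insert _ _)]
  filter_upwards [marginal_ae_lt_top (A := P) hm (by simp [hint])] with x hx
  exact ENNReal.inv_mul_cancel (marginal_pos hμ hm (fun x => (hpos x).1) x).ne' hx.ne

theorem condDensity_ae_pos_lt_top (hμ : ∀ i, μ i ≠ 0) (hf : f ∈ posDensities μ) :
    ∀ᵐ x ∂Measure.pi μ, 0 < condDensity μ f a P x ∧ condDensity μ f a P x < ∞ := by
  obtain ⟨hm, hpos, hint⟩ := hf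
  have hp := fun A x => marginal_pos (A := A) hμ hm (fun x => (hpos x).1) x
  filter_upwards [marginal_ae_lt_top (A := P) hm (by simp [hint]),
    marginal_ae_lt_top (A := insert a P) hm (by simp [hint])] with x h₁ h₂
  exact ⟨ENNReal.div_pos (hp _ x).ne' h₁.ne, ENNReal.div_lt_top h₂.ne (hp _ x).ne'⟩

end Marginals

/-! ### Extremal vertices and ancestral sets -/

namespace DAG

variable {p : ℕ} {D : DAG p} {a b : Fin p}

@[simp] theorem mem_parents : b ∈ D.parents a ↔ D.Adj b a := by
  simp [parents]

theorem irrefl (D : DAG p) (a : Fin p) : ¬ D.Adj a a :=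
  fun h => D.acyclic a (.single h)

theorem asymm (h : D.Adj a b) : ¬ D.Adj b a :=
  fun h' => D.acyclic a (.tail (.single h) h')

theorem ne_of_adj (h : D.Adj a b) : a ≠ b :=
  fun hab => D.irrefl b (hab ▸ h)

theorem notMem_parents_self (D : DAG p) (a : Fin p) : a ∉ D.parents a := by
  simpa using D.irrefl a

theorem exists_minimal (D : DAG p) {s : Set (Fin p)} (hs : s.Nonempty) :
    ∃ a ∈ s, ∀ b ∈ s, ¬ Relation.TransGen D.Adj b a := by
  have : Std.Irrefl (Relation.TransGen D.Adj) := ⟨D.acyclic⟩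
  exact (Finite.wellFounded_of_trans_of_irrefl (Relation.TransGen D.Adj)).has_min s hs

theorem exists_maximal (D : DAG p) {s : Set (Fin p)} (hs : s.Nonempty) :
    ∃ a ∈ s, ∀ b ∈ s, ¬ Relation.TransGen D.Adj a b := by
  have : Std.Irrefl (Function.swap (Relation.TransGen D.Adj)) := ⟨D.acyclic⟩
  have : IsTrans _ (Function.swap (Relation.TransGen D.Adj)) := ⟨fun _ _ _ h h' => h'.trans h⟩
  exact (Finite.wellFounded_of_trans_of_irrefl
    (Function.swap (Relation.TransGen D.Adj))).has_min s hs

/-- A set of vertices is ancestral if it contains the parents of its elements. -/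
def IsAncestral (D : DAG p) (A : Finset (Fin p)) : Prop :=
  ∀ ⦃a b⦄, D.Adj a b → b ∈ A → a ∈ A

theorem IsAncestral.parents_subset {A : Finset (Fin p)} (hA : D.IsAncestral A) (ha : a ∈ A) :
    D.parents a ⊆ A :=
  fun _ hb => hA (mem_parents.mp hb) ha

theorem IsAncestral.dependsOn_prod {X : Fin p → Type*} {q : Fin p → (∀ i, X i) → ℝ≥0∞}
    (hqd : ∀ a, DependsOn (q a) (↑(insert a (D.parents a)) : Set (Fin p)))
    {A : Finset (Fin p)} (hA : D.IsAncestral A) :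
    DependsOn (fun x => ∏ a ∈ A, q a x) (A : Set (Fin p)) := by
  intro x y h
  refine Finset.prod_congr rfl fun a ha => hqd a fun i hi => h i ?_
  exact Finset.insert_subset ha (hA.parents_subset ha) hi

theorem exists_isAncestral_insert (D : DAG p) (a : Fin p) :
    ∃ C, D.IsAncestral C ∧ a ∉ C ∧ D.parents a ⊆ C ∧ D.IsAncestral (insert a C) := by
  classical
  -- `C` is the set of non-descendants of `a`.
  refine ⟨Finset.univ.filter fun b => ¬ Relation.ReflTransGen D.Adj a b, ?_, ?_, ?_, ?_⟩
  · intro b c hbc hc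
    simp only [Finset.mem_filter, Finset.mem_univ, true_and] at hc ⊢
    exact fun h => hc (h.tail hbc)
  · simp [Relation.ReflTransGen.refl]
  · intro b hb
    simp only [Finset.mem_filter, Finset.mem_univ, true_and]
    exact fun h => D.acyclic a (Relation.TransGen.tail' h (mem_parents.mp hb))
  · intro b c hbc hc
    simp only [Finset.mem_insert, Finset.mem_filter, Finset.mem_univ, true_and] at hc ⊢
    right
    rcases hc with rfl | hc
    · exact fun h => D.acyclic c (Relation.TransGen.tail' h hbc)
    · exact fun h => hc (h.tail hbc)

end DAG

/-! ### Products of normalized kernels along a DAG -/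

section Factorization

variable {p : ℕ} {X : Fin p → Type*} [∀ i, MeasurableSpace (X i)]
  {μ : ∀ i, Measure (X i)} [∀ i, SigmaFinite (μ i)] {D : DAG p}
  {f : (∀ i, X i) → ℝ≥0∞} {q : Fin p → (∀ i, X i) → ℝ≥0∞}

/-- Integrating a product of normalized conditional densities over the complement of an ancestral
set leaves the factors of the elements of that set. -/
theorem marginal_prod_ae_eq (hqm : ∀ a, Measurable (q a))
    (hqd : ∀ a, DependsOn (q a) (↑(insert a (D.parents a)) : Set (Fin p)))
    (hq1 : ∀ a, lmarginal μ {a} (q a) =ᵐ[Measure.pi μ] 1) {A : Finset (Fin p)}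
    (hA : D.IsAncestral A) :
    marginal μ (fun x => ∏ a, q a x) A =ᵐ[Measure.pi μ] fun x => ∏ a ∈ A, q a x := by
  have hm : ∀ B : Finset (Fin p), Measurable fun x => ∏ a ∈ B, q a x :=
    fun B => Finset.measurable_fun_prod _ fun a _ => hqm a
  induction hn : Aᶜ.card generalizing A with
  | zero =>
    rw [Finset.card_eq_zero, Finset.compl_eq_empty_iff] at hn
    rw [hn, marginal_univ]
  | succ n ih =>
    have hne : ((Aᶜ : Finset (Fin p)) : Set (Fin p)).Nonempty := by
      rw [Finset.coe_nonempty, ← Finset.card_pos]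
      omega
    -- A minimal vertex outside `A` has all its parents in `A`, so adding it keeps the set
    -- ancestral. The factors of `A` do not involve its coordinate, and its own factor integrates to
    -- one.
    obtain ⟨a, ha, hmin⟩ := D.exists_minimal hne
    have haA : a ∉ A := by simpa using ha
    have hpa : D.parents a ⊆ A := fun b hb => by
      by_contra hbA
      exact hmin b (by simpa using hbA) (.single (DAG.mem_parents.mp hb))
    have hB : D.IsAncestral (insert a A) := by
      intro b c hbc hc
      rcases Finset.mem_insert.mp hc with rfl | hc
      · exact Finset.mem_insert_of_mem (hpa (DAG.mem_parents.mpr hbc))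
      · exact Finset.mem_insert_of_mem (hA hbc hc)
    have hcard : (insert a A)ᶜ.card = n := by
      rw [Finset.card_compl, Finset.card_insert_of_notMem haA]
      rw [Finset.card_compl] at hn
      omega
    have h₁ : marginal μ (fun x => ∏ a, q a x) A
        = lmarginal μ {a} (marginal μ (fun x => ∏ a, q a x) (insert a A)) := by
      have hsd : insert a A \ A = {a} := by ext i; simp; grind
      rw [← lmarginal_marginal (hm _) (Finset.subset_insert a A), hsd]
    have h₂ : (fun x => ∏ b ∈ insert a A, q b x) = fun x => (∏ b ∈ A, q b x) * q a x := by
      ext x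
      rw [Finset.prod_insert haA, mul_comm]
    rw [h₁]
    refine (lmarginal_ae_congr (measurable_marginal (hm _)) (hm _) (ih hB hcard)).trans ?_
    rw [h₂, lmarginal_mul_of_dependsOn (hA.dependsOn_prod hqd)
      (Finset.disjoint_singleton_right.mpr haA) (hqm a)]
    filter_upwards [hq1 a] with x hx
    simp [hx]

theorem lintegral_prod_eq_one (hμ : ∀ i, μ i ≠ 0) (hqm : ∀ a, Measurable (q a))
    (hqd : ∀ a, DependsOn (q a) (↑(insert a (D.parents a)) : Set (Fin p)))
    (hq1 : ∀ a, lmarginal μ {a} (q a) =ᵐ[Measure.pi μ] 1) :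
    ∫⁻ x, ∏ a, q a x ∂(Measure.pi μ) = 1 := by
  have h := marginal_prod_ae_eq hqm hqd hq1 (A := ∅) (fun _ _ _ h => by simp at h)
  rw [marginal_empty] at h
  have : (ae (Measure.pi μ)).NeBot := ae_neBot.mpr (pi_ne_zero hμ)
  obtain ⟨x, hx⟩ := h.exists
  simpa using hx

/-- The factors of a product of normalized conditional densities are the conditional densities
of the product. -/
theorem condDensity_prod_ae_eq (hμ : ∀ i, μ i ≠ 0) (hqm : ∀ a, Measurable (q a))
    (hqpos : ∀ a x, 0 < q a x)
    (hqd : ∀ a, DependsOn (q a) (↑(insert a (D.parents a)) : Set (Fin p)))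
    (hq1 : ∀ a, lmarginal μ {a} (q a) =ᵐ[Measure.pi μ] 1) (a : Fin p) :
    condDensity μ (fun x => ∏ a, q a x) a (D.parents a) =ᵐ[Measure.pi μ] q a := by
  have hm : ∀ B : Finset (Fin p), Measurable fun x => ∏ a ∈ B, q a x :=
    fun B => Finset.measurable_fun_prod _ fun a _ => hqm a
  -- On `C ∪ {a}` the marginal is `q a` times the product over `C`. Integrating out `C` minus the
  -- parents leaves `q a` times the marginal of the parents.
  obtain ⟨C, hC, haC, hpC, hB⟩ := D.exists_isAncestral_insert a
  have hsd : insert a C \ insert a (D.parents a) = C \ D.parents a := by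
    ext i; simp; grind
  have h₁ : marginal μ (fun x => ∏ a, q a x) (D.parents a)
      =ᵐ[Measure.pi μ] lmarginal μ (C \ D.parents a) fun x => ∏ b ∈ C, q b x := by
    rw [← lmarginal_marginal (hm _) hpC]
    exact lmarginal_ae_congr (measurable_marginal (hm _)) (hm _)
      (marginal_prod_ae_eq hqm hqd hq1 hC)
  have h₂ : marginal μ (fun x => ∏ a, q a x) (insert a (D.parents a)) =ᵐ[Measure.pi μ]
      fun x => q a x * lmarginal μ (C \ D.parents a) (fun x => ∏ b ∈ C, q b x) x := by
    rw [← lmarginal_marginal (hm _) (Finset.insert_subset_insert a hpC), hsd,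
      ← lmarginal_mul_of_dependsOn (hqd a) _ (hm C)]
    · refine lmarginal_ae_congr (measurable_marginal (hm _)) ((hqm a).mul (hm C)) ?_
      refine (marginal_prod_ae_eq hqm hqd hq1 hB).trans (.of_eq ?_)
      ext x
      exact Finset.prod_insert haC
    · rw [← hsd]
      exact Finset.disjoint_sdiff
  have hint : ∫⁻ x, ∏ a, q a x ∂(Measure.pi μ) ≠ ∞ := by
    rw [lintegral_prod_eq_one hμ hqm hqd hq1]
    simp
  filter_upwards [h₁, h₂, marginal_ae_lt_top (A := D.parents a) (hm _) hint] with x hx₁ hx₂ hx₃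
  have hpos : 0 < marginal μ (fun x => ∏ a, q a x) (D.parents a) x :=
    marginal_pos hμ (hm _)
      (fun x => (Finset.prod_ne_zero_iff.mpr fun b _ => (hqpos b x).ne').bot_lt) x
  rw [condDensity, hx₂, ← hx₁]
  exact ENNReal.mul_div_cancel_right hpos.ne' hx₃.ne

/-- Conditional densities of `f` given subsets of the parent sets of `D` are the conditional
densities of some element of `M(D)`. -/
theorem exists_mem_markovDensities (hμ : ∀ i, μ i ≠ 0) (hf : f ∈ posDensities μ) (D : DAG p)
    (Q : Fin p → Finset (Fin p)) (hQ : ∀ a, Q a ⊆ D.parents a) :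
    ∃ g ∈ markovDensities μ D,
      g =ᵐ[Measure.pi μ] (fun x => ∏ a, condDensity μ f a (Q a) x) ∧
      ∀ a, condDensity μ g a (D.parents a) =ᵐ[Measure.pi μ] condDensity μ f a (Q a) := by
  classical
  have hcm : ∀ a, Measurable (condDensity μ f a (Q a)) := fun a => measurable_condDensity hf.1
  let T : Set ℝ≥0∞ := Set.Ioo 0 ∞
  -- Conditional densities can be `0` or `∞` on a null set, whereas members of `posDensities` are
  -- positive and finite everywhere; the default value 1 repairs this.
  let q : Fin p → (∀ i, X i) → ℝ≥0∞ := fun a x =>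
    if condDensity μ f a (Q a) x ∈ T then condDensity μ f a (Q a) x else 1
  have hqm : ∀ a, Measurable (q a) := fun a =>
    Measurable.ite (hcm a measurableSet_Ioo) (hcm a) measurable_const
  have hq : ∀ a x, 0 < q a x ∧ q a x < ∞ := fun a x => by
    by_cases h : condDensity μ f a (Q a) x ∈ T
    · simp only [q, if_pos h]
      exact h
    · simp [q, if_neg h]
  have hqd : ∀ a, DependsOn (q a) (↑(insert a (D.parents a)) : Set (Fin p)) := fun a x y h => by
    have := dependsOn_condDensity μ f a (Q a) fun i hi =>
      h i (Finset.insert_subset_insert a (hQ a) hi)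
    simp only [q, this]
  have hqf : ∀ a, q a =ᵐ[Measure.pi μ] condDensity μ f a (Q a) := fun a => by
    filter_upwards [condDensity_ae_pos_lt_top (a := a) (P := Q a) hμ hf] with x hx
    exact if_pos hx
  have hq1 : ∀ a, lmarginal μ {a} (q a) =ᵐ[Measure.pi μ] 1 := fun a =>
    (lmarginal_ae_congr (hqm a) (hcm a) (hqf a)).trans
      (lmarginal_condDensity hμ hf fun h => D.notMem_parents_self a (hQ a h))
  have hc := condDensity_prod_ae_eq hμ hqm (fun a x => (hq a x).1) hqd hq1
  refine ⟨fun x => ∏ a, q a x, ⟨⟨Finset.measurable_fun_prod _ fun a _ => hqm a, fun x => ⟨?_, ?_⟩,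
    lintegral_prod_eq_one hμ hqm hqd hq1⟩, ?_⟩, ?_, fun a => (hc a).trans (hqf a)⟩
  · exact (Finset.prod_ne_zero_iff.mpr fun a _ => (hq a x).1.ne').bot_lt
  · exact ENNReal.prod_lt_top fun a _ => (hq a x).2
  · filter_upwards [ae_all_iff.mpr hc] with x hx
    exact Finset.prod_congr rfl fun a _ => (hx a).symm
  · filter_upwards [ae_all_iff.mpr hqf] with x hx
    exact Finset.prod_congr rfl fun a _ => hx a

theorem markovDensities_ae_congr {g : (∀ i, X i) → ℝ≥0∞} (hf : f ∈ posDensities μ)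
    (hg : g ∈ markovDensities μ D) (h : f =ᵐ[Measure.pi μ] g) : f ∈ markovDensities μ D := by
  refine ⟨hf, (h.trans hg.2).trans ?_⟩
  have := fun a => condDensity_ae_congr (a := a) (P := D.parents a) hf.1 hg.1.1 h
  filter_upwards [ae_all_iff.mpr this] with x hx
  exact Finset.prod_congr rfl fun a _ => (hx a).symm

theorem DAG.parents_intervene (D : DAG p) (I : Finset (Fin p)) (a : Fin p) :
    (D.intervene I).parents a = if a ∈ I then ∅ else D.parents a := by
  ext b
  by_cases h : a ∈ I <;> simp [h, DAG.intervene]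

/-- Complete `f` to a tuple: for target `k`, keep the kernels of `f` at vertices outside `I k` and
use its one-vertex marginals inside. Kernels outside the targets do not depend on `k`, so the tuple
is compatible, and its `j`-th entry is `f` almost everywhere. -/
theorem markovDensities_subset_of_interventionalDensities_subset (hμ : ∀ i, μ i ≠ 0)
    {D₁ D₂ : DAG p} {J : ℕ} {I : Fin J → Finset (Fin p)}
    (h : interventionalDensities μ I D₁ ⊆ interventionalDensities μ I D₂) (j : Fin J) :
    markovDensities μ (D₁.intervene (I j)) ⊆ markovDensities μ (D₂.intervene (I j)) := by
  intro f hf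
  let Q : Fin J → Fin p → Finset (Fin p) := fun k a =>
    if a ∈ I k then ∅ else (D₁.intervene (I j)).parents a
  have hQ : ∀ k a, Q k a ⊆ (D₁.intervene (I k)).parents a := fun k a => by
    simp only [Q, DAG.parents_intervene]
    split_ifs <;> simp
  choose g hg hgf hgc using fun k =>
    exists_mem_markovDensities hμ hf.1 (D₁.intervene (I k)) (Q k) (hQ k)
  have hmem : g ∈ interventionalDensities μ I D₁ := by
    refine ⟨hg, fun k l a ha => ?_⟩
    simp only [Finset.mem_union, not_or] at ha
    have hk := hgc k a
    have hl := hgc l a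
    simp only [Q, DAG.parents_intervene, if_neg ha.1, if_neg ha.2] at hk hl
    exact hk.trans hl.symm
  refine markovDensities_ae_congr hf.1 ((h hmem).1 j) (.trans hf.2 (.trans ?_ (hgf j).symm))
  have hQj : Q j = (D₁.intervene (I j)).parents := by
    ext1 a
    simp only [Q, DAG.parents_intervene]
    split_ifs <;> rfl
  rw [hQj]

end Factorization

/-! ### Test densities with pure parity dependence -/

section ParityDensity

/-- Take a positive integrable function and rescale it separately on `A` and on its complement; `B`
only ensures that the complement has positive measure. -/
theorem exists_density_with_fair_event {α : Type*} [MeasurableSpace α] (μ : Measure α)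
    [SigmaFinite μ] {A B : Set α} (hA : MeasurableSet A) (hAB : Disjoint A B)
    (hμA : 0 < μ A) (hμB : 0 < μ B) :
    ∃ φ : α → ℝ≥0∞, Measurable φ ∧ (∀ x, 0 < φ x ∧ φ x < ∞) ∧
      ∫⁻ x in A, φ x ∂μ = 2⁻¹ ∧ ∫⁻ x in Aᶜ, φ x ∂μ = 2⁻¹ := by
  classical
  obtain ⟨h, hpos, hm, hint⟩ := exists_pos_lintegral_lt_of_sigmaFinite μ (ε := 1) one_ne_zero
  have hm' : Measurable fun x => (h x : ℝ≥0∞) := hm.coe_nnreal_ennreal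
  have key : ∀ s, MeasurableSet s → 0 < μ s →
      (∫⁻ x in s, h x ∂μ) ≠ 0 ∧ (∫⁻ x in s, h x ∂μ) ≠ ∞ := fun s hs hμs => by
    refine ⟨?_, ((setLIntegral_le_lintegral s _).trans_lt (hint.trans ENNReal.one_lt_top)).ne⟩
    refine (setLIntegral_pos_iff hm' |>.mpr ?_).ne'
    have : Function.support (fun x => (h x : ℝ≥0∞)) = Set.univ := by
      ext x
      simpa using (hpos x).ne'
    simpa [this] using hμs
  have hA' := key A hA hμA
  have hB' := key Aᶜ hA.compl (hμB.trans_le (measure_mono hAB.subset_compl_left))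
  set cA := ∫⁻ x in A, h x ∂μ
  set cB := ∫⁻ x in Aᶜ, h x ∂μ
  have calc_half : ∀ c : ℝ≥0∞, c ≠ 0 ∧ c ≠ ∞ → (2 * c)⁻¹ * c = 2⁻¹ := fun c hc => by
    rw [ENNReal.mul_inv (by simp) (by simp), mul_assoc, ENNReal.inv_mul_cancel hc.1 hc.2, mul_one]
  refine ⟨fun x => if x ∈ A then (2 * cA)⁻¹ * h x else (2 * cB)⁻¹ * h x,
    Measurable.ite hA (hm'.const_mul _) (hm'.const_mul _), fun x => ?_, ?_, ?_⟩
  · have hx : ∀ c : ℝ≥0∞, c ≠ 0 ∧ c ≠ ∞ → 0 < (2 * c)⁻¹ * h x ∧ (2 * c)⁻¹ * h x < ∞ :=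
      fun c hc => ⟨ENNReal.mul_pos (ENNReal.inv_ne_zero.mpr (ENNReal.mul_ne_top (by simp) hc.2))
        (by simpa using (hpos x).ne'), ENNReal.mul_lt_top
        (ENNReal.inv_lt_top.mpr (ENNReal.mul_pos (by simp) hc.1)) (by simp)⟩
    by_cases hxA : x ∈ A
    · simpa only [if_pos hxA] using hx cA hA'
    · simpa only [if_neg hxA] using hx cB hB'
  · rw [setLIntegral_congr_fun (g := fun x => (2 * cA)⁻¹ * h x) hA fun x hx => if_pos hx,
      lintegral_const_mul _ hm']
    exact calc_half cA hA'
  · rw [setLIntegral_congr_fun (g := fun x => (2 * cB)⁻¹ * h x) hA.compl fun x hx => if_neg hx,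
      lintegral_const_mul _ hm']
    exact calc_half cB hB'

variable {p : ℕ} {X : Fin p → Type*}

open Classical in
/-- The product of the signs `±1`, over `i ∈ S`, that tell whether `x i` lies in `B i`. -/
noncomputable def paritySign (B : ∀ i, Set (X i)) (S : Finset (Fin p)) (x : ∀ i, X i) : ℝ :=
  ∏ i ∈ S, if x i ∈ B i then 1 else -1

/-- The density `1 + (1/2) ∏ i ∈ S, ±1` with respect to a product of fair distributions; all of
its proper marginals are trivial. -/
noncomputable def parityFactor (B : ∀ i, Set (X i)) (S : Finset (Fin p)) (x : ∀ i, X i) : ℝ≥0∞ :=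
  ENNReal.ofReal (1 + paritySign B S x / 2)

/-- The density of coordinates whose only dependence is through the parity of `S`. -/
noncomputable def parityDensity (φ : ∀ i, X i → ℝ≥0∞) (B : ∀ i, Set (X i)) (S : Finset (Fin p))
    (x : ∀ i, X i) : ℝ≥0∞ :=
  (∏ i, φ i (x i)) * parityFactor B S x

variable {B : ∀ i, Set (X i)} {S : Finset (Fin p)} {x : ∀ i, X i}

theorem paritySign_eq_or (B : ∀ i, Set (X i)) (S : Finset (Fin p)) (x : ∀ i, X i) :
    paritySign B S x = 1 ∨ paritySign B S x = -1 := by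
  classical
  refine Finset.prod_induction _ (fun r : ℝ => r = 1 ∨ r = -1) ?_ (.inl rfl) fun i _ => ?_
  · rintro a b (rfl | rfl) (rfl | rfl) <;> simp
  · split_ifs <;> simp

theorem parityFactor_pos_lt_top (B : ∀ i, Set (X i)) (S : Finset (Fin p)) (x : ∀ i, X i) :
    0 < parityFactor B S x ∧ parityFactor B S x < ∞ := by
  refine ⟨ENNReal.ofReal_pos.mpr ?_, ENNReal.ofReal_lt_top⟩
  rcases paritySign_eq_or B S x with h | h <;> rw [h] <;> norm_num

theorem parityFactor_ne_one (B : ∀ i, Set (X i)) (S : Finset (Fin p)) (x : ∀ i, X i) :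
    parityFactor B S x ≠ 1 := by
  rw [parityFactor, Ne, ENNReal.ofReal_eq_one]
  rcases paritySign_eq_or B S x with h | h <;> rw [h] <;> norm_num

theorem parityFactor_update_of_notMem {i : Fin p} (hi : i ∉ S) (y : X i) :
    parityFactor B S (Function.update x i y) = parityFactor B S x := by
  unfold parityFactor paritySign
  congr 3
  refine Finset.prod_congr rfl fun k hk => ?_
  rw [Function.update_of_ne (ne_of_mem_of_not_mem hk hi)]

variable [∀ i, MeasurableSpace (X i)] {μ : ∀ i, Measure (X i)} {φ : ∀ i, X i → ℝ≥0∞}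

theorem measurable_parityFactor (hB : ∀ i, MeasurableSet (B i)) :
    Measurable (parityFactor B S) := by
  classical
  refine ENNReal.measurable_ofReal.comp (measurable_const.add (Measurable.div_const ?_ 2))
  exact Finset.measurable_fun_prod S fun i _ =>
    Measurable.ite (measurable_pi_apply i (hB i)) measurable_const measurable_const

theorem measurable_parityDensity (hφ : ∀ i, Measurable (φ i)) (hB : ∀ i, MeasurableSet (B i)) :
    Measurable (parityDensity φ B S) :=
  (Finset.measurable_fun_prod _ fun i _ => (hφ i).comp (measurable_pi_apply i)).mul
    (measurable_parityFactor hB)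

/-- Averaging over one fair sign cancels the parity term: `(1 + t/2)/2 + (1 - t/2)/2 = 1`. -/
theorem lintegral_mul_parityFactor_update {i : Fin p} (hi : i ∈ S) (hB : MeasurableSet (B i))
    (h₁ : ∫⁻ y in B i, φ i y ∂μ i = 2⁻¹) (h₂ : ∫⁻ y in (B i)ᶜ, φ i y ∂μ i = 2⁻¹) :
    ∫⁻ y, φ i y * parityFactor B S (Function.update x i y) ∂μ i = 1 := by
  classical
  set t := paritySign B (S.erase i) x with ht
  have hs : ∀ y, paritySign B S (Function.update x i y) = (if y ∈ B i then 1 else -1) * t := by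
    intro y
    rw [paritySign, ← Finset.mul_prod_erase S _ hi, Function.update_self, ht, paritySign]
    congr 1
    refine Finset.prod_congr rfl fun k hk => ?_
    rw [Function.update_of_ne (Finset.ne_of_mem_erase hk)]
  rw [← lintegral_add_compl _ hB,
    setLIntegral_congr_fun (g := fun y => φ i y * ENNReal.ofReal (1 + t / 2)) hB fun y hy => by
      simp [parityFactor, hs, hy],
    setLIntegral_congr_fun (g := fun y => φ i y * ENNReal.ofReal (1 - t / 2)) hB.compl
      fun y hy => by
        have hy' : y ∉ B i := hy
        simp only [parityFactor, hs, if_neg hy']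
        congr 2
        ring,
    lintegral_mul_const' _ _ ENNReal.ofReal_ne_top, lintegral_mul_const' _ _ ENNReal.ofReal_ne_top,
    h₁, h₂, ← mul_add, ← ENNReal.ofReal_add]
  · norm_num
    exact ENNReal.inv_mul_cancel (by simp) (by simp)
  all_goals rcases paritySign_eq_or B (S.erase i) x with h | h <;> rw [ht, h] <;> norm_num

variable [∀ i, SigmaFinite (μ i)]

theorem lmarginal_parityDensity (hφ : ∀ i, Measurable (φ i)) (hB : ∀ i, MeasurableSet (B i))
    (h₁ : ∀ i, ∫⁻ y in B i, φ i y ∂μ i = 2⁻¹) (h₂ : ∀ i, ∫⁻ y in (B i)ᶜ, φ i y ∂μ i = 2⁻¹)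
    (T : Finset (Fin p)) (x : ∀ i, X i) :
    lmarginal μ T (parityDensity φ B S) x
      = (∏ i ∈ Tᶜ, φ i (x i)) * if Disjoint S T then parityFactor B S x else 1 := by
  have hone : ∀ i, ∫⁻ y, φ i y ∂μ i = 1 := fun i => by
    rw [← lintegral_add_compl _ (hB i), h₁, h₂, ENNReal.inv_two_add_inv_two]
  induction T using Finset.induction generalizing x with
  | empty => simp [parityDensity]
  | insert i T hi ih =>
    have hc : (Tᶜ : Finset (Fin p)) = insert i (insert i T)ᶜ := by
      ext k; simp; grind
    have hprod : ∀ y, ∏ k ∈ Tᶜ, φ k (Function.update x i y k)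
        = (∏ k ∈ (insert i T)ᶜ, φ k (x k)) * φ i y := fun y => by
      rw [hc, Finset.prod_insert (by simp), Function.update_self, mul_comm]
      congr 1
      refine Finset.prod_congr rfl fun k hk => ?_
      rw [Function.update_of_ne (by rintro rfl; simp at hk)]
    have hmu : Measurable fun y => parityFactor B S (Function.update x i y) :=
      (measurable_parityFactor hB).comp (measurable_update x)
    rw [lmarginal_insert _ (measurable_parityDensity hφ hB) hi]
    simp only [ih, hprod, mul_assoc]
    rw [lintegral_const_mul]
    · congr 1
      by_cases hST : Disjoint S T
      · by_cases hiS : i ∈ S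
        · have : ¬ Disjoint S (insert i T) := fun h =>
            Finset.disjoint_left.mp h hiS (Finset.mem_insert_self i T)
          simp only [if_pos hST, if_neg this]
          exact lintegral_mul_parityFactor_update hiS (hB i) (h₁ i) (h₂ i)
        · have : Disjoint S (insert i T) := Finset.disjoint_insert_right.mpr ⟨hiS, hST⟩
          simp only [if_pos hST, if_pos this, parityFactor_update_of_notMem hiS]
          rw [lintegral_mul_const _ (hφ i), hone, one_mul]
      · have : ¬ Disjoint S (insert i T) := fun h =>
          hST (Finset.disjoint_of_subset_right (Finset.subset_insert i T) h)
        simp only [if_neg hST, if_neg this, mul_one, hone]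
    · by_cases hST : Disjoint S T
      · simp only [if_pos hST]
        exact (hφ i).mul hmu
      · simpa only [if_neg hST, mul_one] using hφ i

theorem marginal_parityDensity (hφ : ∀ i, Measurable (φ i)) (hB : ∀ i, MeasurableSet (B i))
    (h₁ : ∀ i, ∫⁻ y in B i, φ i y ∂μ i = 2⁻¹) (h₂ : ∀ i, ∫⁻ y in (B i)ᶜ, φ i y ∂μ i = 2⁻¹)
    (A : Finset (Fin p)) (x : ∀ i, X i) :
    marginal μ (parityDensity φ B S) A x
      = (∏ i ∈ A, φ i (x i)) * if S ⊆ A then parityFactor B S x else 1 := by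
  rw [marginal, lmarginal_parityDensity hφ hB h₁ h₂, compl_compl]
  simp only [← Finset.subset_compl_iff_disjoint_right, compl_compl]

theorem parityDensity_mem_posDensities (hφ : ∀ i, Measurable (φ i))
    (hφ' : ∀ i y, 0 < φ i y ∧ φ i y < ∞) (hB : ∀ i, MeasurableSet (B i))
    (h₁ : ∀ i, ∫⁻ y in B i, φ i y ∂μ i = 2⁻¹) (h₂ : ∀ i, ∫⁻ y in (B i)ᶜ, φ i y ∂μ i = 2⁻¹)
    (hμ : ∀ i, μ i ≠ 0) (hS : S.Nonempty) : parityDensity φ B S ∈ posDensities μ := by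
  refine ⟨measurable_parityDensity hφ hB, fun x => ⟨?_, ?_⟩, ?_⟩
  · exact ENNReal.mul_pos (Finset.prod_ne_zero_iff.mpr fun i _ => (hφ' i _).1.ne')
      (parityFactor_pos_lt_top B S x).1.ne'
  · exact ENNReal.mul_lt_top (ENNReal.prod_lt_top fun i _ => (hφ' i _).2)
      (parityFactor_pos_lt_top B S x).2
  · have : (ae (Measure.pi μ)).NeBot := ae_neBot.mpr (pi_ne_zero hμ)
    obtain ⟨x, -⟩ := (Filter.Eventually.of_forall (f := ae (Measure.pi μ))
      fun _ => trivial).exists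
    have := marginal_parityDensity (S := S) hφ hB h₁ h₂ ∅ x
    rw [marginal_empty] at this
    simpa [hS.ne_empty] using this

/-- The parity factor appears in a marginal only when all of `S` is observed. If `S ⊆ P` already, it
cancels in the quotient, so it survives exactly when `a` completes `S`. -/
theorem condDensity_parityDensity (hφ : ∀ i, Measurable (φ i))
    (hφ' : ∀ i y, 0 < φ i y ∧ φ i y < ∞) (hB : ∀ i, MeasurableSet (B i))
    (h₁ : ∀ i, ∫⁻ y in B i, φ i y ∂μ i = 2⁻¹) (h₂ : ∀ i, ∫⁻ y in (B i)ᶜ, φ i y ∂μ i = 2⁻¹)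
    {a : Fin p} {P : Finset (Fin p)} (ha : a ∉ P) (x : ∀ i, X i) :
    condDensity μ (parityDensity φ B S) a P x
      = φ a (x a) * if a ∈ S ∧ S ⊆ insert a P then parityFactor B S x else 1 := by
  have hP₀ : ∏ i ∈ P, φ i (x i) ≠ 0 := Finset.prod_ne_zero_iff.mpr fun i _ => (hφ' i _).1.ne'
  have hP₁ : ∏ i ∈ P, φ i (x i) ≠ ∞ := (ENNReal.prod_lt_top fun i _ => (hφ' i _).2).ne
  obtain ⟨hu₀, hu₁⟩ := parityFactor_pos_lt_top B S x
  rw [condDensity, marginal_parityDensity hφ hB h₁ h₂, marginal_parityDensity hφ hB h₁ h₂,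
    Finset.prod_insert ha]
  by_cases haS : a ∈ S
  · have : ¬ S ⊆ P := fun h => ha (h haS)
    simp only [haS, true_and, if_neg this, mul_one]
    rw [mul_right_comm]
    exact ENNReal.mul_div_cancel_right hP₀ hP₁
  · have : S ⊆ insert a P ↔ S ⊆ P := Finset.subset_insert_iff_of_notMem haS
    simp only [this, haS, false_and, if_false, mul_one, mul_assoc]
    split_ifs
    · exact ENNReal.mul_div_cancel_right (mul_ne_zero hP₀ hu₀.ne') (ENNReal.mul_ne_top hP₁ hu₁.ne)
    · rw [mul_one]
      exact ENNReal.mul_div_cancel_right hP₀ hP₁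

/-- The product of conditionals contains one parity factor per vertex of `S` whose parents include
the rest of `S`. There is at most one such vertex by acyclicity, and with none the product misses a
factor that is nowhere equal to 1. -/
theorem parityDensity_mem_markovDensities_iff (hφ : ∀ i, Measurable (φ i))
    (hφ' : ∀ i y, 0 < φ i y ∧ φ i y < ∞) (hB : ∀ i, MeasurableSet (B i))
    (h₁ : ∀ i, ∫⁻ y in B i, φ i y ∂μ i = 2⁻¹) (h₂ : ∀ i, ∫⁻ y in (B i)ᶜ, φ i y ∂μ i = 2⁻¹)
    (hμ : ∀ i, μ i ≠ 0) (hS : S.Nonempty) (D : DAG p) :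
    parityDensity φ B S ∈ markovDensities μ D ↔ ∃ a ∈ S, S ⊆ insert a (D.parents a) := by
  have hprod : ∀ x, ∏ a, condDensity μ (parityDensity φ B S) a (D.parents a) x
      = (∏ a, φ a (x a)) *
        ∏ a, if a ∈ S ∧ S ⊆ insert a (D.parents a) then parityFactor B S x else 1 := fun x => by
    rw [← Finset.prod_mul_distrib]
    exact Finset.prod_congr rfl fun a _ =>
      condDensity_parityDensity hφ hφ' hB h₁ h₂ (D.notMem_parents_self a) x
  constructor
  · rintro ⟨-, h⟩
    by_contra! hne
    have : (ae (Measure.pi μ)).NeBot := ae_neBot.mpr (pi_ne_zero hμ)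
    obtain ⟨x, hx⟩ := h.exists
    simp only [hprod] at hx
    rw [Finset.prod_eq_one (fun a _ => if_neg fun h => hne a h.1 h.2), parityDensity] at hx
    have hφ₀ : ∏ i, φ i (x i) ≠ 0 := Finset.prod_ne_zero_iff.mpr fun i _ => (hφ' i (x i)).1.ne'
    have hφ₁ : ∏ i, φ i (x i) ≠ ∞ := (ENNReal.prod_lt_top fun i _ => (hφ' i (x i)).2).ne
    exact parityFactor_ne_one B S x ((ENNReal.mul_right_inj hφ₀ hφ₁).mp hx)
  · rintro ⟨a, haS, ha⟩
    refine ⟨parityDensity_mem_posDensities hφ hφ' hB h₁ h₂ hμ hS, .of_forall fun x => ?_⟩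
    simp only [hprod, parityDensity]
    congr 1
    symm
    rw [Finset.prod_eq_single_of_mem a (Finset.mem_univ a), if_pos ⟨haS, ha⟩]
    refine fun b _ hba => if_neg fun hb => ?_
    have hab : D.Adj b a := by simpa [hba] using ha hb.1
    have hba' : D.Adj a b := by simpa [hba.symm] using hb.2 haS
    exact DAG.asymm hab hba'

theorem exists_parents_iff_of_markovEquiv
    (hμ : ∀ i, ∃ A B : Set (X i), MeasurableSet A ∧ MeasurableSet B ∧ Disjoint A B ∧
      0 < μ i A ∧ 0 < μ i B) {D₁ D₂ : DAG p} (h : MarkovEquiv μ D₁ D₂) (hS : S.Nonempty) :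
    (∃ a ∈ S, S ⊆ insert a (D₁.parents a)) ↔ ∃ a ∈ S, S ⊆ insert a (D₂.parents a) := by
  choose A B hA _ hAB hμA hμB using hμ
  choose φ hφ hφ' h₁ h₂ using fun i =>
    exists_density_with_fair_event (μ i) (hA i) (hAB i) (hμA i) (hμB i)
  have hμ0 : ∀ i, μ i ≠ 0 := fun i h0 => by
    have := hμA i
    simp [h0] at this
  rw [← parityDensity_mem_markovDensities_iff hφ hφ' hA h₁ h₂ hμ0 hS,
    ← parityDensity_mem_markovDensities_iff hφ hφ' hA h₁ h₂ hμ0 hS, h]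

end ParityDensity

/-! ### Skeletons and v-structures -/

namespace DAG

variable {p : ℕ} {D D₁ D₂ D₃ : DAG p} {a b c : Fin p} {I : Finset (Fin p)}

@[ext] theorem ext (h : ∀ a b, D₁.Adj a b ↔ D₂.Adj a b) : D₁ = D₂ := by
  obtain ⟨⟨_⟩, _⟩ := D₁
  obtain ⟨⟨_⟩, _⟩ := D₂
  congr
  ext a b
  exact h a b

theorem skeleton_adj : D.skeleton.Adj a b ↔ D.Adj a b ∨ D.Adj b a := by
  rw [skeleton, SimpleGraph.fromRel_adj]
  exact ⟨And.right, fun h => ⟨h.elim ne_of_adj fun h => (ne_of_adj h).symm, h⟩⟩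

theorem intervene_adj : (D.intervene I).Adj a b ↔ D.Adj a b ∧ b ∉ I :=
  Iff.rfl

theorem mem_vStructures : (a, b, c) ∈ D.vStructures ↔
    a ≠ c ∧ D.Adj a b ∧ D.Adj c b ∧ ¬ D.skeleton.Adj a c :=
  Iff.rfl

/-- Two-element sets `S` suffice: the condition then says that the two vertices are adjacent. -/
theorem skeleton_le_of_exists_parents (h : ∀ S : Finset (Fin p), S.Nonempty →
    (∃ a ∈ S, S ⊆ insert a (D₁.parents a)) → ∃ a ∈ S, S ⊆ insert a (D₂.parents a)) :
    D₁.skeleton ≤ D₂.skeleton := by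
  have key : ∀ a b, D₁.Adj a b → D₂.skeleton.Adj a b := by
    intro a b hab
    have hne := ne_of_adj hab
    obtain ⟨c, hc, hS⟩ := h {a, b} ⟨a, by simp⟩ ⟨b, by simp, by
      intro x hx; simp at hx ⊢; rcases hx with rfl | rfl <;> simp [hab]⟩
    rw [skeleton_adj]
    rcases Finset.mem_insert.mp hc with rfl | hc
    · have := hS (show b ∈ _ by simp)
      right
      simpa [hne.symm] using this
    · obtain rfl := Finset.mem_singleton.mp hc
      have := hS (show a ∈ _ by simp)
      left
      simpa [hne] using this
  intro a b hab
  rcases skeleton_adj.mp hab with h | h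
  · exact key a b h
  · exact (key b a h).symm

/-- For `S = {a, b, c}`, the vertex having the other two as parents must be `b`, since `a` and `c`
are not adjacent. -/
theorem vStructures_subset_of_exists_parents (h : ∀ S : Finset (Fin p), S.Nonempty →
    (∃ a ∈ S, S ⊆ insert a (D₁.parents a)) → ∃ a ∈ S, S ⊆ insert a (D₂.parents a))
    (hsk : D₁.skeleton = D₂.skeleton) : D₁.vStructures ⊆ D₂.vStructures := by
  rintro ⟨a, b, c⟩ ht
  obtain ⟨hac, hab, hcb, hn⟩ := mem_vStructures.mp ht
  have hab' := ne_of_adj hab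
  have hcb' := ne_of_adj hcb
  rw [hsk] at hn
  refine mem_vStructures.mpr ?_
  obtain ⟨d, hd, hS⟩ := h {a, b, c} ⟨a, by simp⟩ ⟨b, by simp, by
      intro x hx; simp at hx ⊢; rcases hx with rfl | rfl | rfl <;> simp [hab, hcb]⟩
  have ha := hS (show a ∈ _ by simp)
  have hc := hS (show c ∈ _ by simp)
  simp only [Finset.mem_insert, mem_parents] at ha hc
  simp only [Finset.mem_insert, Finset.mem_singleton] at hd
  rw [skeleton_adj] at hn ⊢
  grind

theorem adj_of_skeleton_eq (h : D₁.skeleton = D₂.skeleton) (hab : D₁.Adj a b) :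
    D₂.Adj a b ∨ D₂.Adj b a := by
  rw [← skeleton_adj, ← h, skeleton_adj]
  exact .inl hab

/-- Vertices whose orientation differs are separated by no target. -/
theorem mem_iff_of_skeleton_intervene_eq
    (h : (D₁.intervene I).skeleton = (D₂.intervene I).skeleton)
    (h₁ : D₁.Adj a b) (h₂ : D₂.Adj b a) : a ∈ I ↔ b ∈ I := by
  have := SimpleGraph.ext_iff.mp h
  have := congrFun₂ this a b
  simp only [skeleton_adj, intervene_adj, h₁, h₂, asymm h₁, asymm h₂, eq_iff_iff] at this
  tauto

theorem skeleton_le_of_conservative {J : ℕ} {I : Fin J → Finset (Fin p)} (hI : Conservative I)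
    (h : ∀ j, (D₁.intervene (I j)).skeleton = (D₂.intervene (I j)).skeleton) :
    D₁.skeleton ≤ D₂.skeleton := by
  have key : ∀ a b, D₁.Adj a b → D₂.skeleton.Adj a b := by
    intro a b hab
    obtain ⟨j, hj⟩ := hI b
    rw [skeleton_adj]
    exact (adj_of_skeleton_eq (h j) (intervene_adj.mpr ⟨hab, hj⟩)).imp And.left And.left
  intro a b hab
  rcases skeleton_adj.mp hab with h | h
  · exact key a b h
  · exact (key b a h).symm

theorem vStructures_subset_of_conservative {J : ℕ} {I : Fin J → Finset (Fin p)}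
    (hI : Conservative I)
    (h : ∀ j, (D₁.intervene (I j)).vStructures = (D₂.intervene (I j)).vStructures)
    (hsk : D₁.skeleton = D₂.skeleton) : D₁.vStructures ⊆ D₂.vStructures := by
  rintro ⟨a, b, c⟩ ht
  obtain ⟨hac, hab, hcb, hn⟩ := mem_vStructures.mp ht
  -- A target avoiding the collider `b` keeps both of its arrows. Non-adjacency in `D₂` comes from
  -- `hsk`, as intervention may delete an arrow between `a` and `c`.
  obtain ⟨j, hj⟩ := hI b
  have : (a, b, c) ∈ (D₁.intervene (I j)).vStructures := by
    refine mem_vStructures.mpr ⟨hac, ⟨hab, hj⟩, ⟨hcb, hj⟩, fun h' => hn ?_⟩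
    rw [skeleton_adj] at h' ⊢
    exact h'.imp And.left And.left
  rw [h j] at this
  obtain ⟨-, hab', hcb', -⟩ := mem_vStructures.mp this
  exact mem_vStructures.mpr ⟨hac, hab'.1, hcb'.1, hsk ▸ hn⟩

/-! ### Covered arrows and their reversal -/

/-- An arrow `a → b` is covered if the other parents of `b` are the parents of `a`. -/
def Covered (D : DAG p) (a b : Fin p) : Prop :=
  D.parents b = insert a (D.parents a)

theorem Covered.adj (h : D.Covered a b) : D.Adj a b := by
  rw [← mem_parents, h]
  exact Finset.mem_insert_self _ _

theorem Covered.adj_iff (h : D.Covered a b) (hc : c ≠ a) : D.Adj c b ↔ D.Adj c a := by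
  rw [← mem_parents, h, Finset.mem_insert, mem_parents, or_iff_right hc]

/-- Two distinct DAGs with the same skeleton and v-structures disagree on an arrow which is
covered in the first one. -/
theorem exists_covered (hne : D₁ ≠ D₂) (hsk : D₁.skeleton = D₂.skeleton)
    (hv : D₁.vStructures = D₂.vStructures) : ∃ a b, D₁.Covered a b ∧ D₂.Adj b a := by
  have hdiff : {b | ∃ a, D₁.Adj a b ∧ D₂.Adj b a}.Nonempty := by
    by_contra hemp
    have hemp' : ∀ a b, D₁.Adj a b → ¬ D₂.Adj b a := fun a b h h' =>
      hemp ⟨b, a, h, h'⟩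
    refine hne (ext fun a b => ⟨fun h => ?_, fun h => ?_⟩)
    · exact (adj_of_skeleton_eq hsk h).resolve_right (hemp' a b h)
    · exact (adj_of_skeleton_eq hsk.symm h).resolve_right fun h' => hemp' b a h' h
  -- Choose the earliest head `b` of a disagreeing arrow, then the latest tail `a` for it: arrows
  -- into strict ancestors of `b` agree, and so do arrows into `b` from descendants of `a`.
  obtain ⟨b, hb, hbmin⟩ := D₁.exists_minimal hdiff
  obtain ⟨a, ⟨hab, hba⟩, hamax⟩ := D₁.exists_maximal (s := {a | D₁.Adj a b ∧ D₂.Adj b a}) hb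
  refine ⟨a, b, ?_, hba⟩
  have hmin : ∀ c d, D₁.Adj c d → Relation.TransGen D₁.Adj d b → D₂.Adj c d := fun c d hcd hdb =>
    (adj_of_skeleton_eq hsk hcd).resolve_right fun h => hbmin d ⟨c, hcd, h⟩ hdb
  ext c
  simp only [mem_parents, Finset.mem_insert]
  constructor
  · intro hcb
    by_cases hca : c = a
    · exact .inl hca
    right
    by_cases hadj : D₁.skeleton.Adj c a
    · refine (skeleton_adj.mp hadj).resolve_right fun hac => ?_
      have hcb₂ : D₂.Adj c b := (adj_of_skeleton_eq hsk hcb).resolve_right fun h =>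
        hamax c ⟨hcb, h⟩ (.single hac)
      have hac₂ := hmin a c hac (.single hcb)
      -- The cycle `a → c → b → a` would appear in `D₂`.
      exact D₂.acyclic a (((Relation.TransGen.single hac₂).tail hcb₂).tail hba)
    · have : (c, b, a) ∈ D₂.vStructures := hv ▸ mem_vStructures.mpr ⟨hca, hcb, hab, hadj⟩
      exact absurd hba (asymm (mem_vStructures.mp this).2.2.1)
  · rintro (rfl | hca)
    · exact hab
    have hca₂ := hmin c a hca (.single hab)
    have hcb : c ≠ b := fun h => asymm hab (h ▸ hca)
    by_cases hadj : D₁.skeleton.Adj c b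
    · exact (skeleton_adj.mp hadj).resolve_right fun hbc =>
        D₁.acyclic a (((Relation.TransGen.single hab).tail hbc).tail hca)
    · have : (c, a, b) ∈ D₁.vStructures :=
        hv ▸ mem_vStructures.mpr ⟨hcb, hca₂, hba, hsk ▸ hadj⟩
      exact absurd hab (asymm (mem_vStructures.mp this).2.2.1)

/-- The DAG obtained by reversing a covered arrow. -/
def reverse (D : DAG p) (h : D.Covered a b) : DAG p where
  Adj c d := (D.Adj c d ∧ ¬ (c = a ∧ d = b)) ∨ (c = b ∧ d = a)
  acyclic := by
    let R : Fin p → Fin p → Prop := fun c d => D.Adj c d ∧ ¬ (c = a ∧ d = b)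
    have hR : ∀ c d, Relation.ReflTransGen R c d → Relation.ReflTransGen D.Adj c d :=
      fun c d hcd => Relation.ReflTransGen.mono (fun _ _ => And.left) c d hcd
    -- A second path from `a` to `b` ends with some `c → b`, `c ≠ a`; coveredness gives `c → a`,
    -- closing a cycle.
    have hab : ¬ Relation.ReflTransGen R a b := by
      intro hr
      rcases Relation.ReflTransGen.cases_tail hr with hr | ⟨c, hac, hcb, hc⟩
      · exact ne_of_adj h.adj hr.symm
      · have hca : c ≠ a := fun hca => hc ⟨hca, rfl⟩
        exact D.acyclic a (Relation.TransGen.tail' (hR _ _ hac) ((h.adj_iff hca).mp hcb))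
    -- A walk either avoids the new arrow, or reaches `b` before its first use and leaves `a` after
    -- its last one. A closed walk of the second kind gives a path from `a` to `b` in `R`.
    have key : ∀ c d, Relation.TransGen
        (fun c d => (D.Adj c d ∧ ¬ (c = a ∧ d = b)) ∨ (c = b ∧ d = a)) c d →
        Relation.TransGen D.Adj c d ∧ Relation.ReflTransGen R c d ∨
          Relation.ReflTransGen R c b ∧ Relation.ReflTransGen R a d := by
      intro c d hcd
      induction hcd with
      | single hcd =>
        rcases hcd with hcd | ⟨rfl, rfl⟩
        · exact .inl ⟨.single hcd.1, .single hcd⟩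
        · exact .inr ⟨.refl, .refl⟩
      | tail _ hde ih =>
        rcases hde with hde | ⟨rfl, rfl⟩
        · exact ih.imp (fun h => ⟨h.1.tail hde.1, h.2.tail hde⟩) fun h => ⟨h.1, h.2.tail hde⟩
        · exact .inr ⟨ih.elim And.right And.left, .refl⟩
    intro c hc
    rcases key c c hc with h | h
    · exact D.acyclic c h.1
    · exact hab (h.2.trans h.1)

theorem reverse_adj (h : D.Covered a b) {c d : Fin p} :
    (D.reverse h).Adj c d ↔ (D.Adj c d ∧ ¬ (c = a ∧ d = b)) ∨ (c = b ∧ d = a) :=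
  Iff.rfl

theorem parents_reverse_left (h : D.Covered a b) :
    (D.reverse h).parents a = insert b (D.parents a) := by
  have := ne_of_adj h.adj
  ext c
  simp only [mem_parents, reverse_adj, Finset.mem_insert]
  tauto

theorem parents_reverse_right (h : D.Covered a b) : (D.reverse h).parents b = D.parents a := by
  have := ne_of_adj h.adj
  ext c
  simp only [mem_parents, reverse_adj]
  by_cases hc : c = a
  · subst hc
    simp [D.irrefl, this.symm]
  · rw [h.adj_iff hc]
    tauto

theorem parents_reverse_of_ne (h : D.Covered a b) {d : Fin p} (hda : d ≠ a) (hdb : d ≠ b) :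
    (D.reverse h).parents d = D.parents d := by
  ext c
  simp only [mem_parents, reverse_adj]
  tauto

theorem skeleton_reverse (h : D.Covered a b) : (D.reverse h).skeleton = D.skeleton := by
  ext c d
  have := h.adj
  simp only [skeleton_adj, reverse_adj]
  grind

/-- Neither the arrow `a → b` nor its reversal takes part in a v-structure, because every other
parent of the head is adjacent to the tail. Colliders at `a` or `b` formed by common parents are
unaffected. -/
theorem vStructures_reverse (h : D.Covered a b) : (D.reverse h).vStructures = D.vStructures := by
  ext ⟨c, d, e⟩
  have hab := h.adj
  rw [mem_vStructures, mem_vStructures, skeleton_reverse]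
  have hn := asymm hab
  have hne := ne_of_adj hab
  have hc := fun x hx => h.adj_iff (c := x) hx
  simp only [skeleton_adj, reverse_adj]
  grind

theorem intervene_reverse (h : D.Covered a b) (ha : a ∈ I) (hb : b ∈ I) :
    (D.reverse h).intervene I = D.intervene I := by
  ext c d
  simp only [intervene_adj, reverse_adj]
  grind

theorem Covered.intervene (h : D.Covered a b) (ha : a ∉ I) (hb : b ∉ I) :
    (D.intervene I).Covered a b := by
  rw [Covered, parents_intervene, parents_intervene, if_neg ha, if_neg hb, h]

theorem reverse_intervene (h : D.Covered a b) (ha : a ∉ I) (hb : b ∉ I) :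
    (D.reverse h).intervene I = (D.intervene I).reverse (h.intervene ha hb) := by
  ext c d
  simp only [intervene_adj, reverse_adj]
  grind

/-- Two DAGs with the same skeleton and v-structures are connected by a sequence of reversals of
covered arrows on which they disagree. -/
theorem covered_reversal_induction {r : DAG p → DAG p → Prop} (hrefl : ∀ D, r D D)
    (hrev : ∀ D₁ D₂ a b (h : D₁.Covered a b), D₂.Adj b a →
      r (D₁.reverse h) D₂ → r D₁ D₂)
    (hsk : D₁.skeleton = D₂.skeleton) (hv : D₁.vStructures = D₂.vStructures) : r D₁ D₂ := by
  classical
  induction hn : (Finset.univ.filter fun e : Fin p × Fin p =>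
    D₁.Adj e.1 e.2 ∧ D₂.Adj e.2 e.1).card using Nat.strong_induction_on generalizing D₁ with
  | _ n ih =>
    by_cases heq : D₁ = D₂
    · exact heq ▸ hrefl _
    obtain ⟨a, b, h, hba⟩ := exists_covered heq hsk hv
    refine hrev D₁ D₂ a b h hba (ih _ ?_ ((skeleton_reverse h).trans hsk)
      ((vStructures_reverse h).trans hv) rfl)
    rw [← hn]
    -- The pair `(a, b)` leaves the set of disagreements, and `(b, a)` does not enter it, since `D₂`
    -- has the arrow `b → a`.
    refine Finset.card_lt_card ⟨fun e he => ?_, fun hss => ?_⟩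
    · simp only [Finset.mem_filter, Finset.mem_univ, true_and, reverse_adj] at he ⊢
      rcases he with ⟨⟨he, -⟩ | ⟨h₁, h₂⟩, he'⟩
      · exact ⟨he, he'⟩
      · rw [h₁, h₂] at he'
        exact absurd he' (asymm hba)
    · have := @hss (a, b) (by simp [h.adj, hba])
      simp only [Finset.mem_filter, Finset.mem_univ, true_and, reverse_adj] at this
      have hne := ne_of_adj hba
      grind

end DAG

namespace DAG

variable {p : ℕ} {D : DAG p} {a b : Fin p}

theorem Covered.reverse (h : D.Covered a b) : (D.reverse h).Covered b a := by
  rw [Covered, parents_reverse_left, parents_reverse_right]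

theorem reverse_reverse (h : D.Covered a b) : (D.reverse h).reverse h.reverse = D := by
  ext c d
  have hab := h.adj
  have := asymm hab
  simp only [reverse_adj]
  grind

end DAG

/-! ### Covered reversals preserve the density classes -/

section CoveredReversal

variable {p : ℕ} {X : Fin p → Type*} [∀ i, MeasurableSpace (X i)]
  {μ : ∀ i, Measure (X i)} [∀ i, SigmaFinite (μ i)] {D : DAG p}
  {f g : (∀ i, X i) → ℝ≥0∞} {a b : Fin p} {P : Finset (Fin p)}

theorem condDensity_mul_condDensity (hμ : ∀ i, μ i ≠ 0) (hf : f ∈ posDensities μ) :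
    (fun x => condDensity μ f a P x * condDensity μ f b (insert a P) x) =ᵐ[Measure.pi μ]
      fun x => marginal μ f (insert a (insert b P)) x / marginal μ f P x := by
  filter_upwards [marginal_ae_lt_top (A := insert a P) hf.1 (by simp [hf.2.2])] with x hx
  have hpos := marginal_pos (A := insert a P) hμ hf.1 (fun x => (hf.2.1 x).1) x
  rw [condDensity, condDensity, Finset.insert_comm b a, mul_comm]
  simp only [div_eq_mul_inv]
  rw [← mul_assoc, mul_assoc (marginal μ f _ x), ENNReal.inv_mul_cancel hpos.ne' hx.ne, mul_one]

theorem lmarginal_marginal_div_marginal (hf : Measurable f) (hab : a ≠ b) (ha : a ∉ P) :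
    lmarginal μ {a} (fun x => marginal μ f (insert a (insert b P)) x / marginal μ f P x)
      = condDensity μ f b P := by
  have hd : DependsOn (fun x => (marginal μ f P x)⁻¹) (P : Set (Fin p)) := fun x y hxy => by
    simp only [dependsOn_marginal μ f P hxy]
  have hsd : ({a} : Finset (Fin p)) = insert a (insert b P) \ insert b P := by
    ext; simp; grind
  simp only [ENNReal.div_eq_inv_mul]
  rw [lmarginal_mul_of_dependsOn hd (by simpa using ha) (measurable_marginal hf), hsd,
    lmarginal_marginal hf (Finset.subset_insert _ _)]
  ext x
  rw [condDensity, ENNReal.div_eq_inv_mul]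

/-- Agreement of two densities on `f(x_a | x_P)` and `f(x_b | x_a, x_P)` implies agreement on
`f(x_b | x_P)` and `f(x_a | x_b, x_P)`. -/
theorem condDensity_ae_eq_of_swap (hμ : ∀ i, μ i ≠ 0) (hf : f ∈ posDensities μ)
    (hg : g ∈ posDensities μ) (hab : a ≠ b) (ha : a ∉ P)
    (h₁ : condDensity μ f a P =ᵐ[Measure.pi μ] condDensity μ g a P)
    (h₂ : condDensity μ f b (insert a P) =ᵐ[Measure.pi μ] condDensity μ g b (insert a P)) :
    condDensity μ f b P =ᵐ[Measure.pi μ] condDensity μ g b P ∧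
      condDensity μ f a (insert b P) =ᵐ[Measure.pi μ] condDensity μ g a (insert b P) := by
  -- Both factors together determine the joint conditional density of `x_a, x_b` given `x_P`.
  -- Integrating out `x_a` gives one claim; dividing by the positive finite `f(x_b | x_P)` gives the
  -- other.
  have hr : (fun x => marginal μ f (insert a (insert b P)) x / marginal μ f P x) =ᵐ[Measure.pi μ]
      fun x => marginal μ g (insert a (insert b P)) x / marginal μ g P x := by
    refine (condDensity_mul_condDensity hμ hf).symm.trans
      (.trans ?_ (condDensity_mul_condDensity hμ hg))
    filter_upwards [h₁, h₂] with x hx₁ hx₂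
    rw [hx₁, hx₂]
  have hb : condDensity μ f b P =ᵐ[Measure.pi μ] condDensity μ g b P := by
    rw [← lmarginal_marginal_div_marginal hf.1 hab ha,
      ← lmarginal_marginal_div_marginal hg.1 hab ha]
    exact lmarginal_ae_congr ((measurable_marginal hf.1).div (measurable_marginal hf.1))
      ((measurable_marginal hg.1).div (measurable_marginal hg.1)) hr
  refine ⟨hb, ?_⟩
  filter_upwards [hr, hb, condDensity_mul_condDensity (a := b) (b := a) (P := P) hμ hf,
    condDensity_mul_condDensity (a := b) (b := a) (P := P) hμ hg,
    condDensity_ae_pos_lt_top (a := b) (P := P) hμ hf] with x hrx hbx hfx hgx hpos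
  rw [Finset.insert_comm] at hfx hgx
  rw [hrx, ← hgx, hbx] at hfx
  rw [hbx] at hpos
  exact (ENNReal.mul_right_inj hpos.1.ne' hpos.2.ne).mp hfx

/-- Only the factors at `a` and `b` change, and in either orientation their product is the joint
conditional density given the common parents. -/
theorem mem_markovDensities_reverse (hμ : ∀ i, μ i ≠ 0) (h : D.Covered a b)
    (hf : f ∈ markovDensities μ D) : f ∈ markovDensities μ (D.reverse h) := by
  have hab := DAG.ne_of_adj h.adj
  refine ⟨hf.1, hf.2.trans ?_⟩
  filter_upwards [condDensity_mul_condDensity (a := a) (b := b) (P := D.parents a) hμ hf.1,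
    condDensity_mul_condDensity (a := b) (b := a) (P := D.parents a) hμ hf.1] with x hx₁ hx₂
  have hb : b ∈ Finset.univ.erase a := by simp [hab.symm]
  rw [← Finset.mul_prod_erase _ _ (Finset.mem_univ a), ← Finset.mul_prod_erase _ _ hb,
    ← Finset.mul_prod_erase _ _ (Finset.mem_univ a), ← Finset.mul_prod_erase _ _ hb,
    ← mul_assoc, ← mul_assoc, DAG.parents_reverse_left, DAG.parents_reverse_right,
    show D.parents b = insert a (D.parents a) from h, hx₁, Finset.insert_comm, ← hx₂]
  congr 1
  · exact mul_comm _ _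
  · refine Finset.prod_congr rfl fun c hc => ?_
    simp only [Finset.mem_erase, Finset.mem_univ, and_true] at hc
    rw [DAG.parents_reverse_of_ne h hc.2 hc.1]

theorem interventionalDensities_subset_reverse (hμ : ∀ i, μ i ≠ 0) {J : ℕ}
    {I : Fin J → Finset (Fin p)} (h : D.Covered a b) (hI : ∀ j, a ∈ I j ↔ b ∈ I j) :
    interventionalDensities μ I D ⊆ interventionalDensities μ I (D.reverse h) := by
  rintro f ⟨hf, hfc⟩
  constructor
  · intro j
    by_cases ha : a ∈ I j
    · rw [DAG.intervene_reverse h ha ((hI j).mp ha)]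
      exact hf j
    · rw [DAG.reverse_intervene h ha (fun hb => ha ((hI j).mpr hb))]
      exact mem_markovDensities_reverse hμ _ (hf j)
  · intro j k c hc
    -- Swapping requires agreement at both `a` and `b`, available because every target contains both
    -- or neither.
    have key : a ∉ I j ∪ I k → _ := fun ha =>
      condDensity_ae_eq_of_swap hμ (hf j).1 (hf k).1 (DAG.ne_of_adj h.adj)
        (D.notMem_parents_self a) (hfc j k a ha)
        (by simpa only [show D.parents b = insert a (D.parents a) from h] using
          hfc j k b (by simpa [← hI] using ha))
    by_cases hca : c = a
    · subst hca
      rw [DAG.parents_reverse_left]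
      exact (key hc).2
    by_cases hcb : c = b
    · subst hcb
      rw [DAG.parents_reverse_right]
      exact (key (by simpa [hI] using hc)).1
    rw [DAG.parents_reverse_of_ne h hca hcb]
    exact hfc j k c hc

theorem interventionalMarkovEquiv_reverse (hμ : ∀ i, μ i ≠ 0) {J : ℕ}
    {I : Fin J → Finset (Fin p)} (h : D.Covered a b) (hI : ∀ j, a ∈ I j ↔ b ∈ I j) :
    InterventionalMarkovEquiv μ I D (D.reverse h) := by
  refine (interventionalDensities_subset_reverse hμ h hI).antisymm ?_
  have := interventionalDensities_subset_reverse hμ h.reverse fun j => (hI j).symm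
  rwa [DAG.reverse_reverse] at this

theorem DAG.skeleton_intervene_reverse (h : D.Covered a b) {I : Finset (Fin p)}
    (hI : a ∈ I ↔ b ∈ I) : ((D.reverse h).intervene I).skeleton = (D.intervene I).skeleton := by
  by_cases ha : a ∈ I
  · rw [DAG.intervene_reverse h ha (hI.mp ha)]
  · rw [DAG.reverse_intervene h ha (fun hb => ha (hI.mpr hb)), DAG.skeleton_reverse]

/-- Each reversed arrow is one on which the current DAG and `D₂` disagree, so no target separates
its ends. The reversal then preserves `M_I` and also the intervened skeletons, which keeps the
induction going. -/
theorem interventionalMarkovEquiv_of_skeleton_eq (hμ : ∀ i, μ i ≠ 0) {D₁ D₂ : DAG p} {J : ℕ}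
    {I : Fin J → Finset (Fin p)} (hsk : D₁.skeleton = D₂.skeleton)
    (hv : D₁.vStructures = D₂.vStructures)
    (hI : ∀ j, (D₁.intervene (I j)).skeleton = (D₂.intervene (I j)).skeleton) :
    InterventionalMarkovEquiv μ I D₁ D₂ := by
  refine DAG.covered_reversal_induction (r := fun D₁ D₂ =>
    (∀ j, (D₁.intervene (I j)).skeleton = (D₂.intervene (I j)).skeleton) →
      InterventionalMarkovEquiv μ I D₁ D₂) (fun _ _ => rfl) ?_ hsk hv hI
  intro D₁ D₂ a b h hba ih hI
  have hab := fun j => DAG.mem_iff_of_skeleton_intervene_eq (hI j) h.adj hba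
  exact (interventionalMarkovEquiv_reverse hμ h hab).trans
    (ih fun j => (DAG.skeleton_intervene_reverse h (hab j)).trans (hI j))

end CoveredReversal

end CausalDAG

theorem mainTheorem1 {p : ℕ} {X : Fin p → Type*} [∀ i, MeasurableSpace (X i)]
    (μ : ∀ i, Measure (X i)) [∀ i, SigmaFinite (μ i)]
    (hμ : ∀ i, ∃ A B : Set (X i), MeasurableSet A ∧ MeasurableSet B ∧ Disjoint A B ∧
      0 < μ i A ∧ 0 < μ i B)
    (D₁ D₂ : CausalDAG.DAG p) {J : ℕ} (I : Fin J → Finset (Fin p))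
    (hI : CausalDAG.Conservative I) :
    List.TFAE [
      CausalDAG.InterventionalMarkovEquiv μ I D₁ D₂,
      ∀ j, CausalDAG.MarkovEquiv μ (D₁.intervene (I j)) (D₂.intervene (I j)),
      ∀ j, (D₁.intervene (I j)).skeleton = (D₂.intervene (I j)).skeleton ∧
        (D₁.intervene (I j)).vStructures = (D₂.intervene (I j)).vStructures,
      (D₁.skeleton = D₂.skeleton ∧ D₁.vStructures = D₂.vStructures) ∧
        ∀ j, (D₁.intervene (I j)).skeleton = (D₂.intervene (I j)).skeleton] := by
  have hμ0 : ∀ i, μ i ≠ 0 := fun i h => by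
    obtain ⟨A, -, -, -, -, hA, -⟩ := hμ i
    simp [h] at hA
  open CausalDAG CausalDAG.DAG in
  tfae_have 1 → 2 := fun h j =>
    (markovDensities_subset_of_interventionalDensities_subset hμ0 h.subset j).antisymm
      (markovDensities_subset_of_interventionalDensities_subset hμ0 h.superset j)
  tfae_have 2 → 3 := fun h j => by
    have key := fun (S : Finset (Fin p)) (hS : S.Nonempty) =>
      exists_parents_iff_of_markovEquiv hμ (h j) hS
    have hsk := (skeleton_le_of_exists_parents fun S hS => (key S hS).mp).antisymm
      (skeleton_le_of_exists_parents fun S hS => (key S hS).mpr)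
    exact ⟨hsk, (vStructures_subset_of_exists_parents (fun S hS => (key S hS).mp) hsk).antisymm
      (vStructures_subset_of_exists_parents (fun S hS => (key S hS).mpr) hsk.symm)⟩
  tfae_have 3 → 4 := fun h => by
    have hsk := (skeleton_le_of_conservative hI fun j => (h j).1).antisymm
      (skeleton_le_of_conservative hI fun j => (h j).1.symm)
    exact ⟨⟨hsk, (vStructures_subset_of_conservative hI (fun j => (h j).2) hsk).antisymm
      (vStructures_subset_of_conservative hI (fun j => (h j).2.symm) hsk.symm)⟩, fun j => (h j).1⟩
  tfae_have 4 → 1 := fun h => interventionalMarkovEquiv_of_skeleton_eq hμ0 h.1.1 h.1.2 h.2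
  tfae_finish
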